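/- **Setting.** The tensor space $\mathbb R^{m_1+1}\otimes\cdots\otimes\mathbb R^{m_r+1}$ carries the inner product with $\langle x_1\otimes\cdots\otimes x_r,\,y_1\otimes\cdots\otimes y_r\rangle=\prod_i\langle x_i,y_i\rangle$. For a submanifold $\mathbb M$ of the unit sphere of a Euclidean space and $x\in\mathbb M$, let $N_x\mathbb M$ be the normal space of $\mathbb M$ in the sphere, that is, the orthogonal complement of $T_x\mathbb M\oplus\mathbb R x$ in the ambient space. For $a\in N_x\mathbb M$, the Weingarten map $L_a:T_x\mathbb M\to T_x\mathbb M$ is the linear map with $$\langle v,L_a(w)\rangle=\mathrm{II}_x(v,w,a)=\Big\langle \tfrac{\partial v(u)}{\partial w}\Big|_{u=x},\,a\Big\rangle\qquad\text{for all }v,w\in T_x\mathbb M,$$ where $v(u)$ is any smooth local tangent field of $\mathbb M$ with $v(x)=v$. **Proposition.** For $1\le i\le r$ let $\mathbb M_i$ be a smooth embedded submanifold of dimension $n_i$ of the sphere $\mathbb S^{m_i}\subset\mathbb R^{m_i+1}$, let $x_i\in\mathbb M_i$, and put $$\mathbb M=\mathbb M_1\otimes\cdots\otimes\mathbb M_r=\{y_1\otimes\cdots\otimes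 y_r\mid y_i\in\mathbb M_i\},\qquad x=x_1\otimes\cdots\otimes x_r .$$ Assume that the map $\mathbb M_1\times\cdots\times\mathbb M_r\to\mathbb M$, $(y_1,\dots,y_r)\mapsto y_1\otimes\cdots\otimes y_r$, is open at $(x_1,\dots,x_r)$, i.e. maps neighbourhoods of $(x_1,\dots,x_r)$ to neighbourhoods of $x$ in $\mathbb M$. Then, near $x$, $\mathbb M$ is a smooth embedded submanifold of dimension $n_1+\cdots+n_r$ of the unit sphere of the tensor space. Let $a\in N_x\mathbb M$. The Weingarten map $L_a$ of $\mathbb M$ at $x$ exists and is unique, and the following hold. For each $i$ there is a unique vector $a_i$ such that the orthogonal projection of $a$ onto $$R_i=x_1\otimes\cdots\otimes x_{i-1}\otimes N_{x_i}\mathbb M_i\otimes x_{i+1}\otimes\cdots\otimes x_r$$ is $x_1\otimes\cdots\otimes x_{i-1}\otimes a_i\otimes x_{i+1}\otimes\cdots\otimes x_r$; moreover $a_i\in N_{x_i}\mathbb M_i$, and the Weingarten map $L_{a_i}$ of $\mathbb M_i$ at $x_i$ in direction $a_i$ exists and is unique. For every choice of orthonormal bases $v^{(i)}_1,\dots,v^{(i)}_{n_i}$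 of $T_{x_i}\mathbb M_i$, $1\le i\le r$, the tensors $x_1\otimes\cdots\otimes v^{(i)}_k\otimes\cdots\otimes x_r$ (with $v_k^{(i)}$ at the $i$-th place, $1\le i\le r$, $1\le k\le n_i$) form an orthonormal basis of $T_x\mathbb M$, and relative to it $L_a$ is represented by the symmetric block matrix $$\begin{bmatrix} L_1 & L_{1,2} & \cdots & L_{1,r}\\ (L_{1,2})^T & L_2 & \cdots & L_{2,r}\\ \vdots & & \ddots & \vdots\\ (L_{1,r})^T & (L_{2,r})^T & \cdots & L_r\end{bmatrix},$$ where 1. for $i<j$ the off-diagonal block is $$L_{i,j}=\big[\langle x_1\otimes\cdots\otimes v^{(i)}_k\otimes\cdots\otimes v^{(j)}_\ell\otimes\cdots\otimes x_r,\;a\rangle\big]_{1\le k\le n_i,\,1\le\ell\le n_j}\in\mathbb R^{n_i\times n_j},$$ with $v^{(i)}_k$ at the $i$-th and $v^{(j)}_\ell$ at the $j$-th place; 2. the diagonal block $L_i\in\mathbb R^{n_i\times n_i}$ is the matrix of $L_{a_i}$ relative to the basis $v^{(i)}_1,\dots,v^{(i)}_{n_i}$. -/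

import Mathlib

open scoped ContDiff Topology

noncomputable section

/-! ### Submanifolds of the unit sphere of a Euclidean space -/

section Geometry

variable {E : Type*} [NormedAddCommGroup E] [InnerProductSpace ℝ E]

/-- `M` is a smooth embedded `n`-dimensional submanifold of the unit sphere of `E`: it lies in the
sphere and around each of its points it has a smooth local parametrization `φ : U → M ∩ V` by an
open set `U` of `ℝⁿ`, where `V` is open in `E`, the differentials of `φ` are injective, and `φ` is
a homeomorphism of `U` onto `M ∩ V`, with continuous inverse `g`. -/
def IsSphericalSubmanifold (n : ℕ) (M : Set E) : Prop :=
  M ⊆ Metric.sphere (0 : E) 1 ∧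
  ∀ p ∈ M, ∃ (U : Set (EuclideanSpace ℝ (Fin n))) (V : Set E)
    (φ : EuclideanSpace ℝ (Fin n) → E) (g : E → EuclideanSpace ℝ (Fin n)),
    IsOpen U ∧ IsOpen V ∧ p ∈ V ∧ ContDiffOn ℝ ∞ φ U ∧
    (∀ u ∈ U, Function.Injective (fderiv ℝ φ u)) ∧
    φ '' U = M ∩ V ∧ ContinuousOn g (M ∩ V) ∧ Set.LeftInvOn g φ U

/-- The tangent space `T_x M`, as a subspace of the ambient space: the velocities at `x` of smooth
curves in `M` through `x`. (For a submanifold these velocities already form a subspace; the span is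
taken only so that the definition makes sense for every set.) -/
def tangentSpaceAt (M : Set E) (x : E) : Submodule ℝ E :=
  Submodule.span ℝ {v | ∃ (γ : ℝ → E) (ε : ℝ), 0 < ε ∧
    ContDiffOn ℝ ∞ γ (Set.Ioo (-ε) ε) ∧ (∀ t ∈ Set.Ioo (-ε) ε, γ t ∈ M) ∧
    γ 0 = x ∧ HasDerivAt γ v 0}

/-- The normal space `N_x M` of `M` in the unit sphere: the orthogonal complement of `T_x M` in the
tangent space `x^⊥` of the sphere at `x`. -/
def normalSpaceAt (M : Set E) (x : E) : Submodule ℝ E :=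
  (tangentSpaceAt M x)ᗮ ⊓ (Submodule.span ℝ {x})ᗮ

/-- `X` is a smooth tangent field of `M` defined in a neighbourhood of `x` (given, as usual for
smooth maps on subsets of Euclidean space, by a smooth map on an open set of the ambient space
whose values at the points of `M` are tangent to `M`). -/
def IsLocalTangentField (M : Set E) (x : E) (X : E → E) : Prop :=
  ∃ V : Set E, IsOpen V ∧ x ∈ V ∧ ContDiffOn ℝ ∞ X V ∧
    ∀ u ∈ M ∩ V, X u ∈ tangentSpaceAt M u

/-- `L` is the Weingarten map of `M` at `x` in the normal direction `a`: for all tangent vectors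
`v, w`, the number `⟨v, L w⟩` equals the second fundamental form
`II_x(v, w, a) = ⟨∂X/∂w (x), a⟩`, computed with any smooth local tangent field `X` of `M` with
`X(x) = v`. -/
def IsWeingartenMap (M : Set E) (x a : E)
    (L : tangentSpaceAt M x →ₗ[ℝ] tangentSpaceAt M x) : Prop :=
  ∀ (v w : tangentSpaceAt M x) (X : E → E), IsLocalTangentField M x X → X x = (v : E) →
    inner ℝ (fderiv ℝ X x (w : E)) a = inner ℝ v (L w)

end Geometry

/-! ### Tensors -/

/-- The tensor space `ℝ^{m_1+1} ⊗ ⋯ ⊗ ℝ^{m_r+1}` with its Euclidean structure, in coordinates: a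
tensor is the array of its coefficients with respect to the orthonormal basis
`e_{α_1} ⊗ ⋯ ⊗ e_{α_r}`. -/
abbrev TensorSpace {r : ℕ} (m : Fin r → ℕ) : Type :=
  EuclideanSpace ℝ (∀ i : Fin r, Fin (m i + 1))

variable {r : ℕ} {m : Fin r → ℕ}

/-- The multilinear map `(x_1, …, x_r) ↦ x_1 ⊗ ⋯ ⊗ x_r`. -/
def tensorProd : MultilinearMap ℝ (fun i : Fin r => EuclideanSpace ℝ (Fin (m i + 1)))
    (TensorSpace m) where
  toFun x := WithLp.toLp 2 (fun α => ∏ i, x i (α i))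
  map_update_add' x i y z := by
    ext α
    have h : ∀ w, (∏ j, (Function.update x i w) j (α j))
        = w (α i) * ∏ j ∈ Finset.univ.erase i, x j (α j) := by
      intro w
      rw [← Finset.mul_prod_erase _ _ (Finset.mem_univ i), Function.update_self]
      congr 1
      refine Finset.prod_congr rfl fun j hj => ?_
      rw [Function.update_of_ne (Finset.ne_of_mem_erase hj)]
    simp [h, add_mul]
  map_update_smul' x i c y := by
    ext α
    have h : ∀ w, (∏ j, (Function.update x i w) j (α j))
        = w (α i) * ∏ j ∈ Finset.univ.erase i, x j (α j) := by
      intro w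
      rw [← Finset.mul_prod_erase _ _ (Finset.mem_univ i), Function.update_self]
      congr 1
      refine Finset.prod_congr rfl fun j hj => ?_
      rw [Function.update_of_ne (Finset.ne_of_mem_erase hj)]
    simp [h, mul_assoc]

theorem tensorProd_apply (x : ∀ i : Fin r, EuclideanSpace ℝ (Fin (m i + 1)))
    (α : ∀ i : Fin r, Fin (m i + 1)) : tensorProd x α = ∏ i, x i (α i) := rfl

/-- The inner product of the tensor space is the one with
`⟨x_1 ⊗ ⋯ ⊗ x_r, y_1 ⊗ ⋯ ⊗ y_r⟩ = ⟨x_1, y_1⟩ ⋯ ⟨x_r, y_r⟩`. -/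
theorem inner_tensorProd (x y : ∀ i : Fin r, EuclideanSpace ℝ (Fin (m i + 1))) :
    inner ℝ (tensorProd x) (tensorProd y) = ∏ i, inner ℝ (x i) (y i) := by
  simp only [PiLp.inner_apply, tensorProd_apply, RCLike.inner_apply, conj_trivial]
  rw [Finset.prod_univ_sum, Fintype.piFinset_univ]
  exact Finset.sum_congr rfl fun α _ => by rw [Finset.prod_mul_distrib]

open scoped TensorProduct in
/-- The tensor space is the algebraic tensor product, with `tensorProd` as the universal multilinear
map. -/
theorem exists_piTensorProduct_equiv (m : Fin r → ℕ) :
    ∃ e : (⨂[ℝ] i : Fin r, EuclideanSpace ℝ (Fin (m i + 1))) ≃ₗ[ℝ] TensorSpace m,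
      ∀ x : ∀ i : Fin r, EuclideanSpace ℝ (Fin (m i + 1)),
        e (PiTensorProduct.tprod ℝ x) = tensorProd x := by
  refine ⟨(Basis.piTensorProduct fun i =>
    (EuclideanSpace.basisFun (Fin (m i + 1)) ℝ).toBasis).equivFun ≪≫ₗ
      (WithLp.linearEquiv 2 ℝ _).symm, fun x => ?_⟩
  ext α
  simp [tensorProd_apply]

/-- The tensor product `M_1 ⊗ ⋯ ⊗ M_r = {x_1 ⊗ ⋯ ⊗ x_r | x_i ∈ M_i}` of the sets `M_i`. -/
def tensorProductSet (M : ∀ i : Fin r, Set (EuclideanSpace ℝ (Fin (m i + 1)))) :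
    Set (TensorSpace m) :=
  {t | ∃ x : ∀ i : Fin r, EuclideanSpace ℝ (Fin (m i + 1)), (∀ i, x i ∈ M i) ∧ tensorProd x = t}

/-- The tensor `x_1 ⊗ ⋯ ⊗ v ⊗ ⋯ ⊗ x_r`, with `v` at the `i`-th place, as a linear map in `v`. -/
def tensorInsert (x : ∀ i : Fin r, EuclideanSpace ℝ (Fin (m i + 1))) (i : Fin r) :
    EuclideanSpace ℝ (Fin (m i + 1)) →ₗ[ℝ] TensorSpace m :=
  tensorProd.toLinearMap x i

/-- The subspace `R_i = x_1 ⊗ ⋯ ⊗ x_{i-1} ⊗ N_{x_i} M_i ⊗ x_{i+1} ⊗ ⋯ ⊗ x_r`. -/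
def normalSlice (M : ∀ i : Fin r, Set (EuclideanSpace ℝ (Fin (m i + 1))))
    (x : ∀ i : Fin r, EuclideanSpace ℝ (Fin (m i + 1))) (i : Fin r) :
    Submodule ℝ (TensorSpace m) :=
  (normalSpaceAt (M i) (x i)).map (tensorInsert x i)

/-- The off-diagonal block `L_{i,j}` (for `i ≠ j`), with entries
`⟨x_1 ⊗ ⋯ ⊗ v_k^{(i)} ⊗ ⋯ ⊗ v_ℓ^{(j)} ⊗ ⋯ ⊗ x_r, a⟩`. -/
def offDiagonalBlock {n : Fin r → ℕ} (x : ∀ i : Fin r, EuclideanSpace ℝ (Fin (m i + 1)))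
    (v : ∀ i : Fin r, Fin (n i) → EuclideanSpace ℝ (Fin (m i + 1))) (a : TensorSpace m)
    (i j : Fin r) : Matrix (Fin (n i)) (Fin (n j)) ℝ :=
  Matrix.of fun k l =>
    inner ℝ (tensorProd (Function.update (Function.update x i (v i k)) j (v j l))) a

end

/-! Take charts `φ i` of the factors with `φ i (u i) = x i` and put `Φ w = φ₁ w₁ ⊗ ⋯ ⊗ φᵣ wᵣ`.
Tangent vectors of a factor are orthogonal to its base point, so the partial differentials of `Φ` in
different factors have orthogonal ranges and `Φ` is an immersion. The openness hypothesis then makes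
`Φ` a chart of the product set (`exists_isLocalChart_tensorProductSet`).

In any chart `φ`, and for normal `a`, the second fundamental form of `dφ l` and `dφ k` in direction
`a` is `⟨D²φ(k, l), a⟩` (`IsLocalChart.isWeingartenMap_iff`). Riesz representation and the symmetry
of `D²φ` give existence, uniqueness and symmetry of the Weingarten map, and its matrix in the
product basis has the entries `⟨D²Φ, a⟩`.

For two directions in factor `i`, `D²Φ` is `D²φ i` inserted at place `i`. Its product with `a` is
that of `D²φ i` with the contraction `aᵢ` of `a` against the other `x j`, which gives the diagonal
blocks. For directions in two factors, `D²Φ` is the tensor with both tangent vectors inserted, which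
gives the off-diagonal blocks. Contraction is adjoint to the isometric insertion, so inserting `aᵢ`
recovers the projection of `a` onto `Rᵢ`. -/

/-! ### Charts with smooth ambient inverse, tangent spaces and Weingarten maps. -/

section LocalChart

variable {E F : Type*} [NormedAddCommGroup E] [InnerProductSpace ℝ E]
  [NormedAddCommGroup F] [NormedSpace ℝ F]

/-- `φ` parametrizes the part of `M` in the open set `V` by the open set `U`, and `G` is a smooth
map on `V` whose restriction to `M` is the inverse of `φ`. -/
structure IsLocalChart (M : Set E) (φ : F → E) (G : E → F) (U : Set F) (V : Set E) : Prop where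
  isOpen_source : IsOpen U
  isOpen_target : IsOpen V
  contDiffOn : ContDiffOn ℝ ∞ φ U
  contDiffOn_inv : ContDiffOn ℝ ∞ G V
  mem : ∀ u ∈ U, φ u ∈ M
  mem_target : ∀ u ∈ U, φ u ∈ V
  left_inv : ∀ u ∈ U, G (φ u) = u
  inv_mem : ∀ y ∈ M, y ∈ V → G y ∈ U
  right_inv : ∀ y ∈ M, y ∈ V → φ (G y) = y

/-- An immersion that is open onto its image in `M` at a point gives a local chart. -/
theorem exists_isLocalChart [FiniteDimensional ℝ E] [FiniteDimensional ℝ F]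
    {M : Set E} {φ : F → E} {U₀ : Set F} {u₀ : F} (hU₀ : IsOpen U₀) (hu₀ : u₀ ∈ U₀)
    (hφ : ContDiffOn ℝ ∞ φ U₀) (hinj : Function.Injective (fderiv ℝ φ u₀))
    (hM : ∀ u ∈ U₀, φ u ∈ M) (hopen : ∀ N ∈ 𝓝 u₀, φ '' N ∈ 𝓝[M] (φ u₀)) :
    ∃ G U V, IsLocalChart M φ G U V ∧ u₀ ∈ U := by
  have : CompleteSpace F := FiniteDimensional.complete ℝ F
  -- With a linear left inverse `B` of the differential, `f = B ∘ φ` has derivative `id` at `u₀`.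
  -- The inverse function theorem applies to `f`, and `f⁻¹ ∘ B` is a smooth inverse of `φ` defined
  -- on an open subset of the ambient space.
  obtain ⟨B₀, hB₀⟩ := LinearMap.exists_leftInverse_of_injective
    (fderiv ℝ φ u₀ : F →ₗ[ℝ] E) (LinearMap.ker_eq_bot.2 hinj)
  set B : E →L[ℝ] F := LinearMap.toContinuousLinearMap B₀ with hB
  have hBφ : B.comp (fderiv ℝ φ u₀) = ContinuousLinearMap.id ℝ F := by
    ext h; exact congrArg (fun f => f h) hB₀
  have hφat : ∀ u ∈ U₀, ContDiffAt ℝ ∞ φ u := fun u hu => hφ.contDiffAt (hU₀.mem_nhds hu)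
  set f : F → F := fun u => B (φ u) with hf
  have hfat : ∀ u ∈ U₀, ContDiffAt ℝ ∞ f u := fun u hu =>
    B.contDiff.contDiffAt.comp u (hφat u hu)
  have hfd : HasFDerivAt f ((ContinuousLinearEquiv.refl ℝ F : F ≃L[ℝ] F) : F →L[ℝ] F) u₀ := by
    have := B.hasFDerivAt.comp u₀ ((hφat u₀ hu₀).differentiableAt (by simp)).hasFDerivAt
    rw [hBφ] at this
    exact this
  set e := (hfat u₀ hu₀).toOpenPartialHomeomorph f hfd (by simp) with he
  have hecoe : ∀ u, e u = f u := fun u => rfl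
  have hue : u₀ ∈ e.source := (hfat u₀ hu₀).mem_toOpenPartialHomeomorph_source hfd (by simp)
  -- Invertibility of the derivative is an open condition; it makes `e.symm` smooth on all of `T`,
  -- not only at one point.
  have hinv : {u | fderiv ℝ f u ∈ Set.range ((↑) : (F ≃L[ℝ] F) → F →L[ℝ] F)} ∈ 𝓝 u₀ := by
    have hc : ContinuousAt (fderiv ℝ f) u₀ :=
      ((hfat u₀ hu₀).fderiv_right (m := ∞) (by simp)).continuousAt
    apply hc
    rw [hfd.fderiv]
    exact ContinuousLinearEquiv.nhds _
  obtain ⟨S, hSsub, hSo, hS₀⟩ := mem_nhds_iff.1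
    (Filter.inter_mem (Filter.inter_mem (e.open_source.mem_nhds hue) (hU₀.mem_nhds hu₀)) hinv)
  set T : Set F := e.target ∩ e.symm ⁻¹' S with hT
  have hTo : IsOpen T := e.isOpen_inter_preimage_symm hSo
  have hsymm : ContDiffOn ℝ ∞ e.symm T := by
    intro t ht
    obtain ⟨⟨h1, h2⟩, ⟨f', h3⟩⟩ := hSsub ht.2
    refine (e.contDiffAt_symm ht.1 (f₀' := f') ?_ (hfat _ h2)).contDiffWithinAt
    rw [h3]
    exact ((hfat _ h2).differentiableAt (by simp)).hasFDerivAt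
  have hleft : ∀ u ∈ S, e.symm (B (φ u)) = u := fun u hu => e.left_inv (hSsub hu).1.1
  have hST : ∀ u ∈ S, B (φ u) ∈ T := fun u hu =>
    ⟨e.map_source (hSsub hu).1.1, by
      change e.symm (B (φ u)) ∈ S
      rw [hleft u hu]; exact hu⟩
  -- Openness is used here: every point of `M` in `V₁` has the form `φ u` with `u ∈ S`, so no other
  -- sheet of `M` comes close.
  obtain ⟨V₁, hV₁o, hV₁, hV₁sub⟩ := mem_nhdsWithin.1 (hopen S (hSo.mem_nhds hS₀))
  refine ⟨fun y => e.symm (B y), S ∩ φ ⁻¹' V₁, V₁ ∩ B ⁻¹' T, ?_, hS₀, hV₁⟩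
  have hSU : S ⊆ U₀ := fun u hu => (hSsub hu).1.2
  refine ⟨(hφ.continuousOn.mono hSU).isOpen_inter_preimage hSo hV₁o,
    hV₁o.inter (hTo.preimage B.continuous), hφ.mono fun u hu => hSU hu.1,
    hsymm.comp B.contDiff.contDiffOn fun y hy => hy.2, fun u hu => hM u (hSU hu.1),
    fun u hu => ⟨hu.2, hST u hu.1⟩, fun u hu => hleft u hu.1, ?_, ?_⟩
  · intro y hy hyV
    obtain ⟨u, hu, rfl⟩ := hV₁sub ⟨hyV.1, hy⟩
    simp only [hleft u hu]
    exact ⟨hu, hyV.1⟩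
  · intro y hy hyV
    obtain ⟨u, hu, rfl⟩ := hV₁sub ⟨hyV.1, hy⟩
    simp only [hleft u hu]

/-- Continuity of the inverse `g` supplies the openness needed to replace `g` by a smooth ambient
inverse. -/
theorem IsSphericalSubmanifold.exists_isLocalChart [FiniteDimensional ℝ E] {n : ℕ} {M : Set E}
    (hM : IsSphericalSubmanifold n M) {p : E} (hp : p ∈ M) :
    ∃ (φ : EuclideanSpace ℝ (Fin n) → E) (G : E → EuclideanSpace ℝ (Fin n))
      (U : Set (EuclideanSpace ℝ (Fin n))) (V : Set E) (u : EuclideanSpace ℝ (Fin n)),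
      IsLocalChart M φ G U V ∧ u ∈ U ∧ φ u = p := by
  obtain ⟨U, V, φ, g, hU, hV, hpV, hφ, hinj, him, hg, hleft⟩ := hM.2 p hp
  obtain ⟨u, hu, rfl⟩ : p ∈ φ '' U := him ▸ ⟨hp, hpV⟩
  obtain ⟨G, U', V', h, hu'⟩ := _root_.exists_isLocalChart (M := M) hU hu hφ (hinj u hu)
    (fun w hw => (him.subset ⟨w, hw, rfl⟩).1) (by
      intro N hN
      have h1 : φ '' U ∈ 𝓝[M] (φ u) := by
        rw [him]; exact Filter.inter_mem self_mem_nhdsWithin (mem_nhdsWithin_of_mem_nhds (hV.mem_nhds hpV))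
      have h2 : g ⁻¹' N ∈ 𝓝[M ∩ V] (φ u) := by
        apply hg (φ u) ⟨hp, hpV⟩
        rw [hleft hu]; exact hN
      rw [nhdsWithin_inter_of_mem' (mem_nhdsWithin_of_mem_nhds (hV.mem_nhds hpV))] at h2
      filter_upwards [h1, h2] with y hy1 hy2
      obtain ⟨w, hw, rfl⟩ := hy1
      refine ⟨w, ?_, rfl⟩
      have : g (φ w) ∈ N := hy2
      rwa [hleft hw] at this)
  exact ⟨φ, G, U', V', u, h, hu', rfl⟩

namespace IsLocalChart

variable {M : Set E} {φ : F → E} {G : E → F} {U : Set F} {V : Set E} {u : F}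

theorem contDiffAt (h : IsLocalChart M φ G U V) (hu : u ∈ U) : ContDiffAt ℝ ∞ φ u :=
  h.contDiffOn.contDiffAt (h.isOpen_source.mem_nhds hu)

theorem hasFDerivAt (h : IsLocalChart M φ G U V) (hu : u ∈ U) :
    HasFDerivAt φ (fderiv ℝ φ u) u :=
  ((h.contDiffAt hu).differentiableAt (by simp)).hasFDerivAt

theorem contDiffAt_inv (h : IsLocalChart M φ G U V) (hu : u ∈ U) : ContDiffAt ℝ ∞ G (φ u) :=
  h.contDiffOn_inv.contDiffAt (h.isOpen_target.mem_nhds (h.mem_target u hu))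

theorem hasFDerivAt_inv (h : IsLocalChart M φ G U V) (hu : u ∈ U) :
    HasFDerivAt G (fderiv ℝ G (φ u)) (φ u) :=
  ((h.contDiffAt_inv hu).differentiableAt (by simp)).hasFDerivAt

theorem contDiffAt_fderiv (h : IsLocalChart M φ G U V) (hu : u ∈ U) :
    ContDiffAt ℝ ∞ (fderiv ℝ φ) u :=
  (h.contDiffAt hu).fderiv_right (m := ∞) (by simp)

theorem fderiv_inv_fderiv (h : IsLocalChart M φ G U V) (hu : u ∈ U) (k : F) :
    fderiv ℝ G (φ u) (fderiv ℝ φ u k) = k := by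
  have h1 := (h.hasFDerivAt_inv hu).comp u (h.hasFDerivAt hu)
  have h2 : HasFDerivAt (G ∘ φ) (ContinuousLinearMap.id ℝ F) u :=
    (hasFDerivAt_id u).congr_of_eventuallyEq
      (Filter.eventuallyEq_of_mem (h.isOpen_source.mem_nhds hu) fun w hw => h.left_inv w hw)
  exact congrArg (fun f => f k) (h1.unique h2)

theorem fderiv_injective (h : IsLocalChart M φ G U V) (hu : u ∈ U) :
    Function.Injective (fderiv ℝ φ u) :=
  Function.LeftInverse.injective (g := fderiv ℝ G (φ u)) (h.fderiv_inv_fderiv hu)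

/-- A curve in `M` satisfies `γ = φ ∘ G ∘ γ` near `0`, so its velocity lies in the range of `dφ`.
Conversely, `dφ k` is the velocity of `t ↦ φ (u + t k)`. -/
theorem tangentSpaceAt_eq (h : IsLocalChart M φ G U V) (hu : u ∈ U) :
    tangentSpaceAt M (φ u) = LinearMap.range (fderiv ℝ φ u : F →ₗ[ℝ] E) := by
  apply le_antisymm
  · refine Submodule.span_le.2 ?_
    rintro v ⟨γ, ε, hε, hγ, hγM, hγ0, hv⟩
    refine ⟨fderiv ℝ G (φ u) v, ?_⟩
    have hG : HasFDerivAt G (fderiv ℝ G (φ u)) (γ 0) := hγ0 ▸ h.hasFDerivAt_inv hu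
    have hφ : HasFDerivAt φ (fderiv ℝ φ u) (G (γ 0)) := by
      rw [hγ0, h.left_inv u hu]; exact h.hasFDerivAt hu
    have h1 := hφ.comp_hasDerivAt (0 : ℝ) (hG.comp_hasDerivAt (0 : ℝ) hv)
    refine h1.unique (hv.congr_of_eventuallyEq ?_)
    have hV : ∀ᶠ t in 𝓝 (0 : ℝ), γ t ∈ V := hv.continuousAt
      (h.isOpen_target.mem_nhds (hγ0 ▸ h.mem_target u hu))
    filter_upwards [hV, Ioo_mem_nhds (neg_lt_zero.2 hε) hε] with t ht1 ht2
    exact h.right_inv _ (hγM t ht2) ht1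
  · rintro _ ⟨k, rfl⟩
    apply Submodule.subset_span
    have hc : ContDiff ℝ ∞ fun t : ℝ => u + t • k := by fun_prop
    have hU : (fun t : ℝ => u + t • k) ⁻¹' U ∈ 𝓝 (0 : ℝ) :=
      hc.continuous.continuousAt (h.isOpen_source.mem_nhds (by simpa using hu))
    obtain ⟨ε, hε, hsub⟩ := Metric.mem_nhds_iff.1 hU
    rw [Real.ball_eq_Ioo, zero_sub, zero_add] at hsub
    refine ⟨fun t => φ (u + t • k), ε, hε, h.contDiffOn.comp hc.contDiffOn hsub,
      fun t ht => h.mem _ (hsub ht), by simp, ?_⟩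
    have hl : HasDerivAt (fun t : ℝ => u + t • k) k 0 := by
      simpa using ((hasDerivAt_id (0 : ℝ)).smul_const k).const_add u
    refine HasFDerivAt.comp_hasDerivAt (0 : ℝ) (l := φ) ?_ hl
    simpa using h.hasFDerivAt hu

theorem fderiv_mem (h : IsLocalChart M φ G U V) (hu : u ∈ U) (k : F) :
    fderiv ℝ φ u k ∈ tangentSpaceAt M (φ u) := by
  rw [h.tangentSpaceAt_eq hu]; exact ⟨k, rfl⟩

theorem exists_fderiv_eq (h : IsLocalChart M φ G U V) (hu : u ∈ U) (v : tangentSpaceAt M (φ u)) :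
    ∃ l, fderiv ℝ φ u l = v := by
  simpa [h.tangentSpaceAt_eq hu] using v.2

/-- The derivative of a local tangent field along the submanifold, up to tangent vectors, is given
by the second derivative of a parametrization. -/
theorem inner_fderiv_tangentField (h : IsLocalChart M φ G U V) (hu : u ∈ U) {a : E}
    (ha : a ∈ (tangentSpaceAt M (φ u))ᗮ) {X : E → E} (hX : IsLocalTangentField M (φ u) X)
    (k l : F) (hl : X (φ u) = fderiv ℝ φ u l) :
    inner ℝ (fderiv ℝ X (φ u) (fderiv ℝ φ u k)) a =
      inner ℝ (fderiv ℝ (fderiv ℝ φ) u k l) a := by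
  obtain ⟨W, hW, huW, hXW, hXt⟩ := hX
  have hXat : ContDiffAt ℝ ∞ X (φ u) := hXW.contDiffAt (hW.mem_nhds huW)
  have hXφ := (hXat.differentiableAt (by simp)).hasFDerivAt.comp u (h.hasFDerivAt hu)
  -- The coordinates of the field: `X ∘ φ = dφ (c)` near `u`. By the product rule the derivative is
  -- `D²φ(k, c u)` plus a value of `dφ`, which is tangent and hence orthogonal to `a`.
  set c : F → F := fun w => fderiv ℝ G (φ w) (X (φ w)) with hc
  have hcd : DifferentiableAt ℝ c u := by
    have h1 : ContDiffAt ℝ ∞ (fun w => fderiv ℝ G (φ w)) u :=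
      ((h.contDiffAt_inv hu).fderiv_right (m := ∞) (by simp)).comp u (h.contDiffAt hu)
    exact (h1.clm_apply (hXat.comp u (h.contDiffAt hu))).differentiableAt (by simp)
  have hdd : HasFDerivAt (fderiv ℝ φ) (fderiv ℝ (fderiv ℝ φ) u) u :=
    ((h.contDiffAt_fderiv hu).differentiableAt (by simp)).hasFDerivAt
  have h2 := hdd.clm_apply hcd.hasFDerivAt
  have heq : X ∘ φ =ᶠ[𝓝 u] fun w => fderiv ℝ φ w (c w) := by
    have hev : ∀ᶠ w in 𝓝 u, φ w ∈ W := (h.contDiffAt hu).continuousAt (hW.mem_nhds huW)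
    filter_upwards [hev, h.isOpen_source.mem_nhds hu] with w hw hwU
    have := hXt (φ w) ⟨h.mem w hwU, hw⟩
    rw [h.tangentSpaceAt_eq hwU] at this
    obtain ⟨b, hb⟩ := this
    have hb' : fderiv ℝ φ w b = X (φ w) := hb
    simp only [hc, Function.comp, ← hb', h.fderiv_inv_fderiv hwU]
  have h3 := congrArg (fun f => f k) (hXφ.unique (h2.congr_of_eventuallyEq heq))
  have hcu : c u = l := by simp only [hc, hl, h.fderiv_inv_fderiv hu]
  simp only [ContinuousLinearMap.comp_apply, add_apply,
    ContinuousLinearMap.flip_apply, hcu] at h3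
  rw [h3, inner_add_left, (Submodule.mem_orthogonal _ _).1 ha _ (h.fderiv_mem hu _), zero_add]

/-- The field with constant coordinates `l` extends any prescribed tangent vector, so the condition
defining a Weingarten map is never vacuous. -/
theorem isLocalTangentField (h : IsLocalChart M φ G U V) (hu : u ∈ U) (l : F) :
    IsLocalTangentField M (φ u) fun y => fderiv ℝ φ (G y) l := by
  obtain ⟨W, hWo, hW⟩ : ∃ W, IsOpen W ∧ W = V ∩ G ⁻¹' U :=
    ⟨_, h.contDiffOn_inv.continuousOn.isOpen_inter_preimage h.isOpen_target h.isOpen_source, rfl⟩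
  subst hW
  refine ⟨_, hWo, ⟨h.mem_target u hu, by simpa [h.left_inv u hu] using hu⟩, ?_, ?_⟩
  · have h1 : ContDiffOn ℝ ∞ (fderiv ℝ φ) U :=
      h.contDiffOn.fderiv_of_isOpen h.isOpen_source (by simp)
    exact (h1.comp (h.contDiffOn_inv.mono Set.inter_subset_left) fun y hy => hy.2).clm_apply
      contDiffOn_const
  · rintro y ⟨hyM, hyV, hyU⟩
    simpa only [h.right_inv y hyM hyV] using h.fderiv_mem hyU l

theorem isWeingartenMap_iff (h : IsLocalChart M φ G U V) (hu : u ∈ U) {a : E}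
    (ha : a ∈ (tangentSpaceAt M (φ u))ᗮ)
    (L : tangentSpaceAt M (φ u) →ₗ[ℝ] tangentSpaceAt M (φ u)) :
    IsWeingartenMap M (φ u) a L ↔ ∀ v w : tangentSpaceAt M (φ u), ∀ l k : F,
      (v : E) = fderiv ℝ φ u l → (w : E) = fderiv ℝ φ u k →
        inner ℝ v (L w) = inner ℝ (fderiv ℝ (fderiv ℝ φ) u k l) a := by
  constructor
  · intro hL v w l k hv hw
    have hX := h.isLocalTangentField hu l
    have hXu : fderiv ℝ φ (G (φ u)) l = fderiv ℝ φ u l := by rw [h.left_inv u hu]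
    rw [← hL v w _ hX (by rw [hXu, hv]), hw, h.inner_fderiv_tangentField hu ha hX k l hXu]
  · intro hL v w X hX hXv
    obtain ⟨l, hl⟩ := h.exists_fderiv_eq hu v
    obtain ⟨k, hk⟩ := h.exists_fderiv_eq hu w
    rw [hL v w l k hl.symm hk.symm, ← hk,
      h.inner_fderiv_tangentField hu ha hX k l (hXv.trans hl.symm)]

theorem existsUnique_isWeingartenMap [FiniteDimensional ℝ E] [FiniteDimensional ℝ F]
    (h : IsLocalChart M φ G U V)
    (hu : u ∈ U) {a : E} (ha : a ∈ (tangentSpaceAt M (φ u))ᗮ) :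
    ∃! L, IsWeingartenMap M (φ u) a L := by
  set T := tangentSpaceAt M (φ u)
  set d : T →L[ℝ] F := (fderiv ℝ G (φ u)).comp T.subtypeL
  have hd : ∀ (v : T) (l : F), (v : E) = fderiv ℝ φ u l → d v = l := fun v l hv => by
    change fderiv ℝ G (φ u) v = l
    rw [hv, h.fderiv_inv_fderiv hu]
  -- The bilinear form `⟨D²φ(d w, d v), a⟩`, where `d` reads off chart coordinates; its Riesz
  -- representative is `L w`.
  let β : T →ₗ[ℝ] (T →L[ℝ] ℝ) :=
    { toFun := fun w => (innerSL ℝ a).comp ((fderiv ℝ (fderiv ℝ φ) u (d w)).comp d)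
      map_add' := fun w w' => by ext v; simp
      map_smul' := fun c w => by ext v; simp }
  let L : T →ₗ[ℝ] T := (InnerProductSpace.toDual ℝ T).symm.toLinearEquiv.toLinearMap.comp β
  have hLi : ∀ v w : T, inner ℝ v (L w) = inner ℝ (fderiv ℝ (fderiv ℝ φ) u (d w) (d v)) a := by
    intro v w
    rw [real_inner_comm]
    change inner ℝ ((InnerProductSpace.toDual ℝ T).symm (β w)) v = _
    rw [InnerProductSpace.toDual_symm_apply, real_inner_comm]
    rfl
  refine ⟨L, (h.isWeingartenMap_iff hu ha L).2 fun v w l k hv hw => ?_, fun L' hL' => ?_⟩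
  · rw [hLi, hd v l hv, hd w k hw]
  · ext1 w
    refine ext_inner_left ℝ fun v => ?_
    obtain ⟨l, hl⟩ := h.exists_fderiv_eq hu v
    obtain ⟨k, hk⟩ := h.exists_fderiv_eq hu w
    rw [(h.isWeingartenMap_iff hu ha L').1 hL' v w l k hl.symm hk.symm, hLi,
      hd v l hl.symm, hd w k hk.symm]

theorem inner_weingartenMap_comm (h : IsLocalChart M φ G U V) (hu : u ∈ U) {a : E}
    (ha : a ∈ (tangentSpaceAt M (φ u))ᗮ)
    {L : tangentSpaceAt M (φ u) →ₗ[ℝ] tangentSpaceAt M (φ u)}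
    (hL : IsWeingartenMap M (φ u) a L) (v w : tangentSpaceAt M (φ u)) :
    inner ℝ v (L w) = inner ℝ w (L v) := by
  obtain ⟨l, hl⟩ := h.exists_fderiv_eq hu v
  obtain ⟨k, hk⟩ := h.exists_fderiv_eq hu w
  have hs : IsSymmSndFDerivAt ℝ φ u :=
    (h.contDiffAt hu).isSymmSndFDerivAt (by simp only [minSmoothness_of_isRCLikeNormedField]; exact WithTop.coe_le_coe.2 le_top)
  rw [h.isWeingartenMap_iff hu ha] at hL
  rw [hL v w l k hl.symm hk.symm, hL w v k l hk.symm hl.symm, hs.eq]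

theorem comp_continuousLinearEquiv {F' : Type*} [NormedAddCommGroup F'] [NormedSpace ℝ F']
    (h : IsLocalChart M φ G U V) (e : F' ≃L[ℝ] F) :
    IsLocalChart M (φ ∘ e) (e.symm ∘ G) (e ⁻¹' U) V where
  isOpen_source := h.isOpen_source.preimage e.continuous
  isOpen_target := h.isOpen_target
  contDiffOn := h.contDiffOn.comp e.contDiff.contDiffOn fun _ hu => hu
  contDiffOn_inv := e.symm.contDiff.comp_contDiffOn h.contDiffOn_inv
  mem u hu := h.mem _ hu
  mem_target u hu := h.mem_target _ hu
  left_inv u hu := by simp [h.left_inv _ hu]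
  inv_mem y hy hyV := by simpa using h.inv_mem y hy hyV
  right_inv y hy hyV := by simpa using h.right_inv y hy hyV

/-- The model space of `Φ` is a product of Euclidean spaces, whereas the definition requires the
standard one; a linear isomorphism transfers the chart. -/
theorem isSphericalSubmanifold [FiniteDimensional ℝ F] {n : ℕ} (h : IsLocalChart M φ G U V)
    (hM : M ⊆ Metric.sphere 0 1) (hn : Module.finrank ℝ F = n) :
    IsSphericalSubmanifold n (M ∩ V) := by
  refine ⟨fun y hy => hM hy.1, fun p hp => ?_⟩
  have h' := h.comp_continuousLinearEquiv
    (ContinuousLinearEquiv.ofFinrankEq (E := EuclideanSpace ℝ (Fin n)) (F := F) (by simp [hn]))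
  refine ⟨_, V, _, _, h'.isOpen_source, h'.isOpen_target, hp.2, h'.contDiffOn,
    fun u hu => h'.fderiv_injective hu, ?_,
    h'.contDiffOn_inv.continuousOn.mono fun y hy => hy.2, fun u hu => h'.left_inv u hu⟩
  ext y
  constructor
  · rintro ⟨u, hu, rfl⟩
    exact ⟨⟨h'.mem u hu, h'.mem_target u hu⟩, h'.mem_target u hu⟩
  · rintro ⟨⟨hy, hyV⟩, -⟩
    exact ⟨_, h'.inv_mem y hy hyV, h'.right_inv y hy hyV⟩

end IsLocalChart

/-- Differentiate `⟨γ, γ⟩ = 1` along a curve. -/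
theorem tangentSpaceAt_le_orthogonal {M : Set E} (hM : M ⊆ Metric.sphere 0 1) (x : E) :
    tangentSpaceAt M x ≤ (Submodule.span ℝ {x})ᗮ := by
  refine Submodule.span_le.2 ?_
  rintro v ⟨γ, ε, hε, -, hγM, rfl, hv⟩
  refine Submodule.mem_orthogonal_singleton_iff_inner_right.2 ?_
  have h1 := hv.inner ℝ hv
  have h2 : HasDerivAt (fun t => inner ℝ (γ t) (γ t)) 0 0 := by
    refine (hasDerivAt_const (0 : ℝ) (1 : ℝ)).congr_of_eventuallyEq ?_
    filter_upwards [Ioo_mem_nhds (neg_lt_zero.2 hε) hε] with t ht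
    rw [real_inner_self_eq_norm_sq, mem_sphere_zero_iff_norm.1 (hM (hγM t ht)), one_pow]
  have h3 := h1.unique h2
  rw [real_inner_comm (γ 0) v] at h3
  linarith [h3]

end LocalChart

/-! ### Derivatives of products of charts, and the chart of the tensor product set. -/

section TensorCharts

variable {r : ℕ} {m : Fin r → ℕ}

theorem continuous_tensorProd :
    Continuous (tensorProd : MultilinearMap ℝ
      (fun i : Fin r => EuclideanSpace ℝ (Fin (m i + 1))) (TensorSpace m)) := by
  refine (PiLp.continuous_toLp 2 _).comp (continuous_pi fun α => ?_)
  exact continuous_finsetProd _ fun i _ => by fun_prop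

/-- `tensorProd` as a continuous multilinear map. -/
noncomputable def tensorProdL : ContinuousMultilinearMap ℝ
    (fun i : Fin r => EuclideanSpace ℝ (Fin (m i + 1))) (TensorSpace m) :=
  ⟨tensorProd, continuous_tensorProd⟩

variable (x : ∀ i : Fin r, EuclideanSpace ℝ (Fin (m i + 1)))

theorem tensorInsert_apply (i : Fin r) (v : EuclideanSpace ℝ (Fin (m i + 1))) :
    tensorInsert x i v = tensorProd (Function.update x i v) := rfl

theorem tensorInsert_self (i : Fin r) : tensorInsert x i (x i) = tensorProd x := by
  rw [tensorInsert_apply, Function.update_eq_self]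

variable {x}

theorem inner_tensorInsert_self (hx : ∀ i, ‖x i‖ = 1) (i : Fin r)
    (v w : EuclideanSpace ℝ (Fin (m i + 1))) :
    inner ℝ (tensorInsert x i v) (tensorInsert x i w) = inner ℝ v w := by
  rw [tensorInsert_apply, tensorInsert_apply, inner_tensorProd, Finset.prod_eq_single i]
  · simp
  · intro j _ hj
    simp [Function.update_of_ne hj, hx]
  · simp

theorem inner_tensorInsert_of_ne {i j : Fin r} (hij : i ≠ j)
    {v : EuclideanSpace ℝ (Fin (m i + 1))} (hv : inner ℝ v (x i) = 0)
    (w : EuclideanSpace ℝ (Fin (m j + 1))) :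
    inner ℝ (tensorInsert x i v) (tensorInsert x j w) = 0 := by
  rw [tensorInsert_apply, tensorInsert_apply, inner_tensorProd]
  refine Finset.prod_eq_zero (Finset.mem_univ i) ?_
  simpa [Function.update_of_ne hij] using hv

theorem tensorInsert_injective (hx : ∀ i, ‖x i‖ = 1) (i : Fin r) :
    Function.Injective (tensorInsert x i) := by
  refine (injective_iff_map_eq_zero _).2 fun v hv => ?_
  rw [← inner_self_eq_zero (𝕜 := ℝ), ← inner_tensorInsert_self hx i, hv, inner_zero_left]

variable {F : Fin r → Type*} [∀ i, NormedAddCommGroup (F i)] [∀ i, NormedSpace ℝ (F i)]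

/-- The derivative of `w ↦ ψ₁(w₁) ⊗ ⋯ ⊗ ψᵣ(wᵣ)` at a point where `ψᵢ` has the value `x i` and the
derivative `A i`. -/
noncomputable def tensorDeriv (x : ∀ i : Fin r, EuclideanSpace ℝ (Fin (m i + 1)))
    (A : ∀ i, F i →L[ℝ] EuclideanSpace ℝ (Fin (m i + 1))) : (∀ i, F i) →L[ℝ] TensorSpace m :=
  (tensorProdL.linearDeriv x).comp
    (ContinuousLinearMap.pi fun i => (A i).comp (ContinuousLinearMap.proj i))

theorem tensorDeriv_apply (A : ∀ i, F i →L[ℝ] EuclideanSpace ℝ (Fin (m i + 1))) (h : ∀ i, F i) :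
    tensorDeriv x A h = ∑ i, tensorInsert x i (A i (h i)) := by
  simp [tensorDeriv, tensorProdL, ContinuousMultilinearMap.linearDeriv_apply, tensorInsert_apply]
  rfl

theorem tensorDeriv_single (A : ∀ i, F i →L[ℝ] EuclideanSpace ℝ (Fin (m i + 1))) (i : Fin r)
    (k : F i) : tensorDeriv x A (Pi.single i k) = tensorInsert x i (A i k) := by
  rw [tensorDeriv_apply, Finset.sum_eq_single i]
  · simp
  · intro j _ hj
    simp [Pi.single_eq_of_ne hj]
  · simp

theorem hasFDerivAt_tensorProd {ψ : ∀ i, F i → EuclideanSpace ℝ (Fin (m i + 1))}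
    {A : ∀ i, F i →L[ℝ] EuclideanSpace ℝ (Fin (m i + 1))} {u : ∀ i, F i}
    (hψ : ∀ i, HasFDerivAt (ψ i) (A i) (u i)) :
    HasFDerivAt (fun w : ∀ i, F i => tensorProd fun i => ψ i (w i))
      (tensorDeriv (fun i => ψ i (u i)) A) u := by
  have h1 : HasFDerivAt (fun w : ∀ i, F i => fun i => ψ i (w i))
      (ContinuousLinearMap.pi fun i => (A i).comp (ContinuousLinearMap.proj i)) u :=
    hasFDerivAt_pi.2 fun i => (hψ i).comp u (hasFDerivAt_apply i u)
  exact (tensorProdL.hasFDerivAt (fun i => ψ i (u i))).comp u h1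

variable {M : ∀ i : Fin r, Set (EuclideanSpace ℝ (Fin (m i + 1)))}
  {φ : ∀ i, F i → EuclideanSpace ℝ (Fin (m i + 1))}
  {G : ∀ i, EuclideanSpace ℝ (Fin (m i + 1)) → F i} {U : ∀ i, Set (F i)}
  {V : ∀ i : Fin r, Set (EuclideanSpace ℝ (Fin (m i + 1)))} {u : ∀ i, F i}

theorem norm_eq_one_of_isLocalChart (hM : ∀ i, M i ⊆ Metric.sphere 0 1)
    (hφ : ∀ i, IsLocalChart (M i) (φ i) (G i) (U i) (V i)) (hu : ∀ i, u i ∈ U i) (i : Fin r) :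
    ‖φ i (u i)‖ = 1 :=
  mem_sphere_zero_iff_norm.1 (hM i ((hφ i).mem _ (hu i)))

theorem fderiv_tensorProd_chart (hφ : ∀ i, IsLocalChart (M i) (φ i) (G i) (U i) (V i))
    (hu : ∀ i, u i ∈ U i) :
    fderiv ℝ (fun w : ∀ i, F i => tensorProd fun i => φ i (w i)) u =
      tensorDeriv (fun i => φ i (u i)) fun i => fderiv ℝ (φ i) (u i) :=
  (hasFDerivAt_tensorProd fun i => (hφ i).hasFDerivAt (hu i)).fderiv

theorem inner_fderiv_eq_zero (hM : ∀ i, M i ⊆ Metric.sphere 0 1)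
    (hφ : ∀ i, IsLocalChart (M i) (φ i) (G i) (U i) (V i)) (hu : ∀ i, u i ∈ U i) (i : Fin r)
    (k : F i) : inner ℝ (fderiv ℝ (φ i) (u i) k) (φ i (u i)) = 0 :=
  Submodule.mem_orthogonal_singleton_iff_inner_left.1
    (tangentSpaceAt_le_orthogonal (hM i) _ ((hφ i).fderiv_mem (hu i) k))

/-- The summands of `dΦ h` are pairwise orthogonal, so pairing with the `i`-th one isolates its
squared norm. -/
theorem fderiv_tensorProd_chart_injective (hM : ∀ i, M i ⊆ Metric.sphere 0 1)
    (hφ : ∀ i, IsLocalChart (M i) (φ i) (G i) (U i) (V i)) (hu : ∀ i, u i ∈ U i) :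
    Function.Injective (fderiv ℝ (fun w : ∀ i, F i => tensorProd fun i => φ i (w i)) u) := by
  refine (injective_iff_map_eq_zero _).2 fun h hh => funext fun i => ?_
  rw [fderiv_tensorProd_chart hφ hu, tensorDeriv_apply] at hh
  have h1 := congrArg (inner ℝ (tensorInsert (fun i => φ i (u i)) i
    (fderiv ℝ (φ i) (u i) (h i)))) hh
  rw [inner_zero_right, inner_sum, Finset.sum_eq_single i, inner_tensorInsert_self
    (norm_eq_one_of_isLocalChart hM hφ hu), inner_self_eq_zero] at h1
  · exact (hφ i).fderiv_injective (hu i) (by rw [h1, Pi.zero_apply, map_zero])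
  · intro j _ hj
    exact inner_tensorInsert_of_ne hj.symm (inner_fderiv_eq_zero hM hφ hu i _) _
  · simp

/-- For fixed `l`, `w ↦ dΦ_w (Pi.single i l)` is again a tensor product of maps, with `φ i` replaced
by `t ↦ dφᵢ(t) l`. The first-derivative formula thus applies once more; `A` lists the derivatives of
the new factors. -/
theorem fderiv_fderiv_tensorProd_chart (hφ : ∀ i, IsLocalChart (M i) (φ i) (G i) (U i) (V i))
    (hu : ∀ i, u i ∈ U i)
    (hd : DifferentiableAt ℝ (fderiv ℝ fun w : ∀ i, F i => tensorProd fun i => φ i (w i)) u)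
    (i : Fin r) (l : F i) (A : ∀ j, F j →L[ℝ] EuclideanSpace ℝ (Fin (m j + 1)))
    (hAi : A i = (fderiv ℝ (fderiv ℝ (φ i)) (u i)).flip l)
    (hA : ∀ j, j ≠ i → A j = fderiv ℝ (φ j) (u j)) (h : ∀ i, F i) :
    fderiv ℝ (fderiv ℝ fun w : ∀ i, F i => tensorProd fun i => φ i (w i)) u h (Pi.single i l) =
      tensorDeriv (Function.update (fun i => φ i (u i)) i (fderiv ℝ (φ i) (u i) l)) A h := by
  set ψ : ∀ j, F j → EuclideanSpace ℝ (Fin (m j + 1)) :=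
    Function.update φ i fun t => fderiv ℝ (φ i) t l with hψ
  have hψw : ∀ w : ∀ i, F i, (fun j => ψ j (w j)) =
      Function.update (fun i => φ i (w i)) i (fderiv ℝ (φ i) (w i) l) := by
    intro w
    ext1 j
    rcases eq_or_ne j i with rfl | hj
    · simp [hψ]
    · simp [hψ, hj]
  have h1 : HasFDerivAt (fun w : ∀ i, F i => tensorProd fun j => ψ j (w j))
      (tensorDeriv (fun j => ψ j (u j)) A) u := by
    refine hasFDerivAt_tensorProd fun j => ?_
    rcases eq_or_ne j i with rfl | hj
    · rw [hAi]
      simp only [hψ, Function.update_self]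
      have := (((hφ j).contDiffAt_fderiv (hu j)).differentiableAt (by simp)).hasFDerivAt.clm_apply
        (hasFDerivAt_const l (u j))
      simpa using this
    · rw [hA j hj]
      simp only [hψ, Function.update_of_ne hj]
      exact (hφ j).hasFDerivAt (hu j)
  have h2 := hd.hasFDerivAt.clm_apply (hasFDerivAt_const (Pi.single i l : ∀ i, F i) u)
  have hev : (fun w : ∀ i, F i => tensorProd fun j => ψ j (w j)) =ᶠ[𝓝 u] fun w =>
      fderiv ℝ (fun w : ∀ i, F i => tensorProd fun i => φ i (w i)) w (Pi.single i l) := by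
    have hUo : Set.univ.pi U ∈ 𝓝 u := set_pi_mem_nhds Set.finite_univ fun j _ =>
      (hφ j).isOpen_source.mem_nhds (hu j)
    filter_upwards [hUo] with w hw
    rw [fderiv_tensorProd_chart hφ fun j => hw j trivial, tensorDeriv_single, hψw,
      tensorInsert_apply]
  have h3 := congrArg (fun f => f h) (h2.unique (h1.congr_of_eventuallyEq hev.symm))
  rw [hψw] at h3
  simpa using h3

theorem fderiv_fderiv_tensorProd_chart_self
    (hφ : ∀ i, IsLocalChart (M i) (φ i) (G i) (U i) (V i)) (hu : ∀ i, u i ∈ U i)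
    (hd : DifferentiableAt ℝ (fderiv ℝ fun w : ∀ i, F i => tensorProd fun i => φ i (w i)) u)
    (i : Fin r) (k l : F i) :
    fderiv ℝ (fderiv ℝ fun w : ∀ i, F i => tensorProd fun i => φ i (w i)) u
        (Pi.single i k) (Pi.single i l) =
      tensorInsert (fun i => φ i (u i)) i (fderiv ℝ (fderiv ℝ (φ i)) (u i) k l) := by
  rw [fderiv_fderiv_tensorProd_chart hφ hu hd i l (Function.update (fun j => fderiv ℝ (φ j) (u j)) i
    ((fderiv ℝ (fderiv ℝ (φ i)) (u i)).flip l)) (by simp) (fun j hj => by simp [hj]),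
    tensorDeriv_single]
  simp [tensorInsert_apply]

theorem fderiv_fderiv_tensorProd_chart_of_ne
    (hφ : ∀ i, IsLocalChart (M i) (φ i) (G i) (U i) (V i)) (hu : ∀ i, u i ∈ U i)
    (hd : DifferentiableAt ℝ (fderiv ℝ fun w : ∀ i, F i => tensorProd fun i => φ i (w i)) u)
    {i j : Fin r} (hij : j ≠ i) (k : F j) (l : F i) :
    fderiv ℝ (fderiv ℝ fun w : ∀ i, F i => tensorProd fun i => φ i (w i)) u
        (Pi.single j k) (Pi.single i l) =
      tensorProd (Function.update (Function.update (fun i => φ i (u i)) i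
        (fderiv ℝ (φ i) (u i) l)) j (fderiv ℝ (φ j) (u j) k)) := by
  rw [fderiv_fderiv_tensorProd_chart hφ hu hd i l (Function.update (fun j => fderiv ℝ (φ j) (u j)) i
    ((fderiv ℝ (fderiv ℝ (φ i)) (u i)).flip l)) (by simp) (fun j hj => by simp [hj]),
    tensorDeriv_single]
  simp [tensorInsert_apply, hij]

theorem tensorProductSet_subset_sphere (hM : ∀ i, M i ⊆ Metric.sphere 0 1) :
    tensorProductSet M ⊆ Metric.sphere 0 1 := by
  rintro _ ⟨y, hy, rfl⟩
  have h1 : inner ℝ (tensorProd y) (tensorProd y) = (1 : ℝ) := by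
    rw [inner_tensorProd]
    refine Finset.prod_eq_one fun i _ => ?_
    rw [real_inner_self_eq_norm_sq, mem_sphere_zero_iff_norm.1 (hM i (hy i)), one_pow]
  rw [real_inner_self_eq_norm_sq] at h1
  rw [mem_sphere_zero_iff_norm]
  exact (pow_eq_one_iff_of_nonneg (norm_nonneg _) two_ne_zero).1 h1

theorem exists_isLocalChart_tensorProductSet [∀ i, FiniteDimensional ℝ (F i)]
    (hM : ∀ i, M i ⊆ Metric.sphere 0 1)
    (hφ : ∀ i, IsLocalChart (M i) (φ i) (G i) (U i) (V i)) (hu : ∀ i, u i ∈ U i)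
    (hopen : ∀ W : ∀ i : Fin r, Set (EuclideanSpace ℝ (Fin (m i + 1))),
      (∀ i, W i ∈ 𝓝 (φ i (u i))) →
        tensorProductSet (fun i => M i ∩ W i) ∈
          𝓝[tensorProductSet M] (tensorProd fun i => φ i (u i))) :
    ∃ G' U' V', IsLocalChart (tensorProductSet M)
      (fun w : ∀ i, F i => tensorProd fun i => φ i (w i)) G' U' V' ∧ u ∈ U' := by
  refine exists_isLocalChart (U₀ := Set.univ.pi U)
    (isOpen_set_pi Set.finite_univ fun i _ => (hφ i).isOpen_source) (fun i _ => hu i) ?_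
    (fderiv_tensorProd_chart_injective hM hφ hu)
    (fun w hw => ⟨_, fun i => (hφ i).mem _ (hw i trivial), rfl⟩) ?_
  · refine tensorProdL.contDiff.comp_contDiffOn (contDiffOn_pi.2 fun i => ?_)
    exact (hφ i).contDiffOn.comp (ContinuousLinearMap.proj (R := ℝ) (φ := F) i).contDiff.contDiffOn fun w hw => hw i trivial
  · intro N hN
    rw [nhds_pi] at hN
    obtain ⟨I, -, t, ht, hsub⟩ := Filter.mem_pi.1 hN
    -- A coordinate box in `N`, pulled back by the inverses `G i`, becomes a box of neighbourhoods
    -- of the points `φ i (u i)`, the form that `hopen` accepts.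
    refine Filter.mem_of_superset (hopen (fun i => V i ∩ G i ⁻¹' t i) fun i => ?_) ?_
    · refine Filter.inter_mem ((hφ i).isOpen_target.mem_nhds ((hφ i).mem_target _ (hu i))) ?_
      apply ((hφ i).contDiffAt_inv (hu i)).continuousAt
      rw [(hφ i).left_inv _ (hu i)]
      exact ht i
    · rintro _ ⟨y, hy, rfl⟩
      refine ⟨fun i => G i (y i), hsub fun i _ => (hy i).2.2, ?_⟩
      exact congrArg tensorProd (funext fun i => (hφ i).right_inv _ (hy i).1 (hy i).2.1)

end TensorCharts

/-! ### Contraction, projection onto the slices, and the product basis. -/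

section TensorWeingarten

variable {r : ℕ} {m : Fin r → ℕ} {x : ∀ i : Fin r, EuclideanSpace ℝ (Fin (m i + 1))}
  {M : ∀ i : Fin r, Set (EuclideanSpace ℝ (Fin (m i + 1)))}

/-- The contraction of a tensor with `x` in all places but the `i`-th. -/
noncomputable def tensorContract (x : ∀ i : Fin r, EuclideanSpace ℝ (Fin (m i + 1))) (i : Fin r) :
    TensorSpace m →ₗ[ℝ] EuclideanSpace ℝ (Fin (m i + 1)) :=
  LinearMap.adjoint (tensorInsert x i)

theorem inner_tensorInsert_left (i : Fin r) (b : EuclideanSpace ℝ (Fin (m i + 1)))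
    (a : TensorSpace m) : inner ℝ (tensorInsert x i b) a = inner ℝ b (tensorContract x i a) :=
  (LinearMap.adjoint_inner_right _ _ _).symm

theorem tensorContract_mem_normalSpaceAt
    (hT : ∀ i, ∀ w ∈ tangentSpaceAt (M i) (x i),
      tensorInsert x i w ∈ tangentSpaceAt (tensorProductSet M) (tensorProd x))
    {a : TensorSpace m} (ha : a ∈ normalSpaceAt (tensorProductSet M) (tensorProd x)) (i : Fin r) :
    tensorContract x i a ∈ normalSpaceAt (M i) (x i) := by
  refine ⟨(Submodule.mem_orthogonal _ _).2 fun w hw => ?_,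
    Submodule.mem_orthogonal_singleton_iff_inner_right.2 ?_⟩
  · rw [← inner_tensorInsert_left]
    exact (Submodule.mem_orthogonal _ _).1 ha.1 _ (hT i w hw)
  · rw [← inner_tensorInsert_left, tensorInsert_self]
    exact Submodule.mem_orthogonal_singleton_iff_inner_right.1 ha.2

/-- Insertion `J` is an isometry with adjoint the contraction, so `a - J J* a` is orthogonal to the
whole range of `J`; normality of `J* a` places `J J* a` in the slice. -/
theorem starProjection_normalSlice (hx : ∀ i, ‖x i‖ = 1) {a : TensorSpace m} {i : Fin r}
    (ha : tensorContract x i a ∈ normalSpaceAt (M i) (x i)) :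
    (normalSlice M x i).starProjection a = tensorInsert x i (tensorContract x i a) := by
  have hmem : tensorInsert x i (tensorContract x i a) ∈ normalSlice M x i :=
    Submodule.mem_map_of_mem ha
  refine Submodule.eq_starProjection_of_mem_orthogonal hmem ?_
  refine (Submodule.mem_orthogonal _ _).2 ?_
  rintro _ ⟨b, -, rfl⟩
  rw [inner_sub_right, inner_tensorInsert_self hx, inner_tensorInsert_left, sub_self]

/-- Insertion of orthonormal bases of the tangent spaces of the factors gives an orthonormal basis
of a space of the right dimension that contains the resulting tensors. -/
theorem exists_orthonormalBasis_tensorInsert {n : Fin r → ℕ} (hx : ∀ i, ‖x i‖ = 1)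
    {T : ∀ i : Fin r, Submodule ℝ (EuclideanSpace ℝ (Fin (m i + 1)))}
    (hTx : ∀ i, ∀ w ∈ T i, inner ℝ w (x i) = 0) {S : Submodule ℝ (TensorSpace m)}
    (hTS : ∀ i, ∀ w ∈ T i, tensorInsert x i w ∈ S) (hS : Module.finrank ℝ S = ∑ i, n i)
    (v : ∀ i : Fin r, OrthonormalBasis (Fin (n i)) ℝ (T i)) :
    ∃ B : OrthonormalBasis (Σ i : Fin r, Fin (n i)) ℝ S,
      ∀ i k, (B ⟨i, k⟩ : TensorSpace m) = tensorInsert x i (v i k) := by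
  let b : (Σ i : Fin r, Fin (n i)) → S := fun p => ⟨_, hTS p.1 _ (v p.1 p.2).2⟩
  have hb : Orthonormal ℝ b := by
    refine orthonormal_iff_ite.2 ?_
    rintro ⟨i, k⟩ ⟨j, l⟩
    rw [Submodule.coe_inner]
    rcases eq_or_ne i j with rfl | hij
    · change inner ℝ (tensorInsert x i (v i k)) (tensorInsert x i (v i l)) = _
      rw [inner_tensorInsert_self hx, ← Submodule.coe_inner,
        orthonormal_iff_ite.1 (v i).orthonormal k l]
      simp
    · rw [if_neg fun h => hij (congrArg Sigma.fst h)]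
      exact inner_tensorInsert_of_ne hij (hTx i _ (v i k).2) _
  have hspan : Submodule.span ℝ (Set.range b) = ⊤ :=
    hb.linearIndependent.span_eq_top_of_card_eq_finrank' (by simp [hS])
  exact ⟨OrthonormalBasis.mk hb hspan.ge, fun i k => by rw [OrthonormalBasis.coe_mk]⟩

theorem toMatrix_orthonormalBasis_apply {ι E : Type*} [Fintype ι] [DecidableEq ι]
    [NormedAddCommGroup E] [InnerProductSpace ℝ E] (b : OrthonormalBasis ι ℝ E) (L : E →ₗ[ℝ] E)
    (p q : ι) : LinearMap.toMatrix b.toBasis b.toBasis L p q = inner ℝ (b p) (L (b q)) := by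
  rw [LinearMap.toMatrix_apply, b.coe_toBasis, b.coe_toBasis_repr_apply, b.repr_apply_apply]

end TensorWeingarten

/-! ### The block matrix of the Weingarten map. -/

theorem proposition2p2 {r : ℕ} (m n : Fin r → ℕ)
    (M : ∀ i : Fin r, Set (EuclideanSpace ℝ (Fin (m i + 1))))
    (hM : ∀ i, IsSphericalSubmanifold (n i) (M i))
    (x : ∀ i : Fin r, EuclideanSpace ℝ (Fin (m i + 1))) (hx : ∀ i, x i ∈ M i)
    -- the tensor product map `M_1 × ⋯ × M_r → M_1 ⊗ ⋯ ⊗ M_r` is open at `(x_1, …, x_r)`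
    (hopen : ∀ U : ∀ i : Fin r, Set (EuclideanSpace ℝ (Fin (m i + 1))),
      (∀ i, U i ∈ 𝓝 (x i)) →
        tensorProductSet (fun i => M i ∩ U i) ∈ 𝓝[tensorProductSet M] (tensorProd x)) :
    -- near `x_1 ⊗ ⋯ ⊗ x_r`, the tensor product is a submanifold of the sphere
    (∃ V : Set (TensorSpace m), IsOpen V ∧ tensorProd x ∈ V ∧
      IsSphericalSubmanifold (∑ i, n i) (tensorProductSet M ∩ V)) ∧
    ∀ a ∈ normalSpaceAt (tensorProductSet M) (tensorProd x),
      -- the projection of `a` onto `R_i` is `x_1 ⊗ ⋯ ⊗ a_i ⊗ ⋯ ⊗ x_r`, and `a_i` is normal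
      ∃ a' : ∀ i : Fin r, EuclideanSpace ℝ (Fin (m i + 1)),
        (∀ i b, tensorInsert x i b = (normalSlice M x i).starProjection a ↔ b = a' i) ∧
        (∀ i, a' i ∈ normalSpaceAt (M i) (x i)) ∧
        -- the Weingarten maps exist and are unique
        (∃! L, IsWeingartenMap (tensorProductSet M) (tensorProd x) a L) ∧
        (∀ i, ∃! Li, IsWeingartenMap (M i) (x i) (a' i) Li) ∧
        -- the matrix of the Weingarten map
        ∀ v : ∀ i : Fin r, OrthonormalBasis (Fin (n i)) ℝ (tangentSpaceAt (M i) (x i)),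
          ∃ B : OrthonormalBasis (Σ i : Fin r, Fin (n i)) ℝ
              (tangentSpaceAt (tensorProductSet M) (tensorProd x)),
            (∀ i k, (B ⟨i, k⟩ : TensorSpace m) = tensorInsert x i (v i k)) ∧
            ∀ L, IsWeingartenMap (tensorProductSet M) (tensorProd x) a L →
              (LinearMap.toMatrix B.toBasis B.toBasis L).IsSymm ∧
              (∀ i Li, IsWeingartenMap (M i) (x i) (a' i) Li →
                (LinearMap.toMatrix B.toBasis B.toBasis L).submatrix (Sigma.mk i) (Sigma.mk i) =
                  LinearMap.toMatrix (v i).toBasis (v i).toBasis Li) ∧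
              ∀ i j, i < j →
                (LinearMap.toMatrix B.toBasis B.toBasis L).submatrix (Sigma.mk i) (Sigma.mk j) =
                  offDiagonalBlock x (fun i k => (v i k : EuclideanSpace ℝ (Fin (m i + 1)))) a
                    i j ∧
                (LinearMap.toMatrix B.toBasis B.toBasis L).submatrix (Sigma.mk j) (Sigma.mk i) =
                  (offDiagonalBlock x (fun i k => (v i k : EuclideanSpace ℝ (Fin (m i + 1)))) a
                    i j).transpose := by
  have hMs : ∀ i, M i ⊆ Metric.sphere 0 1 := fun i => (hM i).1
  choose φ G U V u hφ hu hφx using fun i => (hM i).exists_isLocalChart (hx i)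
  obtain rfl : (fun i => φ i (u i)) = x := funext hφx
  have hx1 := norm_eq_one_of_isLocalChart hMs hφ hu
  obtain ⟨G', U', V', hΦ, huU'⟩ := exists_isLocalChart_tensorProductSet hMs hφ hu hopen
  have hfd := fderiv_tensorProd_chart hφ hu
  have hdd := (hΦ.contDiffAt_fderiv huU').differentiableAt (by simp)
  have hins : ∀ i l, fderiv ℝ (fun w : ∀ i, EuclideanSpace ℝ (Fin (n i)) =>
      tensorProd fun i => φ i (w i)) u (Pi.single i l) =
        tensorInsert (fun i => φ i (u i)) i (fderiv ℝ (φ i) (u i) l) := fun i l => by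
    rw [hfd, tensorDeriv_single]
  have hT : ∀ i, ∀ w ∈ tangentSpaceAt (M i) (φ i (u i)),
      tensorInsert (fun i => φ i (u i)) i w ∈
        tangentSpaceAt (tensorProductSet M) (tensorProd fun i => φ i (u i)) := by
    intro i w hw
    obtain ⟨l, hl⟩ := (hφ i).exists_fderiv_eq (hu i) ⟨w, hw⟩
    have := hΦ.fderiv_mem huU' (Pi.single i l)
    rwa [hins, hl] at this
  have hTx : ∀ i, ∀ w ∈ tangentSpaceAt (M i) (φ i (u i)), inner ℝ w (φ i (u i)) = 0 :=
    fun i w hw => Submodule.mem_orthogonal_singleton_iff_inner_left.1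
      (tangentSpaceAt_le_orthogonal (hMs i) _ hw)
  have hdim : Module.finrank ℝ (tangentSpaceAt (tensorProductSet M)
      (tensorProd fun i => φ i (u i))) = ∑ i, n i := by
    rw [hΦ.tangentSpaceAt_eq huU', LinearMap.finrank_range_of_inj (hΦ.fderiv_injective huU')]
    simp [Module.finrank_pi_fintype]
  refine ⟨⟨V', hΦ.isOpen_target, hΦ.mem_target u huU',
    hΦ.isSphericalSubmanifold (tensorProductSet_subset_sphere hMs)
      (by simp [Module.finrank_pi_fintype])⟩, fun a ha => ?_⟩
  have ha' := tensorContract_mem_normalSpaceAt hT ha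
  refine ⟨fun i => tensorContract (fun i => φ i (u i)) i a, fun i b => ?_, ha',
    hΦ.existsUnique_isWeingartenMap huU' ha.1,
    fun i => (hφ i).existsUnique_isWeingartenMap (hu i) (ha' i).1, fun v => ?_⟩
  · rw [starProjection_normalSlice hx1 (ha' i)]
    exact (tensorInsert_injective hx1 i).eq_iff
  obtain ⟨B, hB⟩ := exists_orthonormalBasis_tensorInsert hx1 hTx hT hdim v
  refine ⟨B, hB, fun L hL => ?_⟩
  have hsymm : (LinearMap.toMatrix B.toBasis B.toBasis L).IsSymm := by
    ext p q
    rw [Matrix.transpose_apply, toMatrix_orthonormalBasis_apply, toMatrix_orthonormalBasis_apply]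
    exact hΦ.inner_weingartenMap_comm huU' ha.1 hL _ _
  have hv : ∀ i k, ∃ l, fderiv ℝ (φ i) (u i) l = v i k := fun i k =>
    (hφ i).exists_fderiv_eq (hu i) (v i k)
  -- `l i k` are the chart coordinates of the `k`-th basis vector of factor `i`; `Pi.single i (l i
  -- k)` are then those of `B ⟨i, k⟩`.
  choose l hl using hv
  have hBl : ∀ i k, (B ⟨i, k⟩ : TensorSpace m) = fderiv ℝ
      (fun w : ∀ i, EuclideanSpace ℝ (Fin (n i)) => tensorProd fun i => φ i (w i)) u
        (Pi.single i (l i k)) := fun i k => by rw [hB, hins, hl]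
  have hent : ∀ i k j k', LinearMap.toMatrix B.toBasis B.toBasis L ⟨i, k⟩ ⟨j, k'⟩ =
      inner ℝ (fderiv ℝ (fderiv ℝ fun w : ∀ i, EuclideanSpace ℝ (Fin (n i)) =>
        tensorProd fun i => φ i (w i)) u (Pi.single j (l j k')) (Pi.single i (l i k))) a := by
    intro i k j k'
    rw [toMatrix_orthonormalBasis_apply]
    exact (hΦ.isWeingartenMap_iff huU' ha.1 L).1 hL _ _ _ _ (hBl i k) (hBl j k')
  have hoff : ∀ i j, i < j →
      (LinearMap.toMatrix B.toBasis B.toBasis L).submatrix (Sigma.mk i) (Sigma.mk j) =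
        offDiagonalBlock (fun i => φ i (u i))
          (fun i k => (v i k : EuclideanSpace ℝ (Fin (m i + 1)))) a i j := by
    intro i j hij
    ext k k'
    -- The column index is the outer direction of differentiation, so place `i` is updated before
    -- place `j`, exactly as in `offDiagonalBlock`.
    rw [Matrix.submatrix_apply, hent, fderiv_fderiv_tensorProd_chart_of_ne hφ hu hdd hij.ne',
      hl, hl]
    rfl
  refine ⟨hsymm, fun i Li hLi => ?_, fun i j hij => ⟨hoff i j hij, ?_⟩⟩
  · ext k k'
    rw [Matrix.submatrix_apply, hent, fderiv_fderiv_tensorProd_chart_self hφ hu hdd,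
      inner_tensorInsert_left, toMatrix_orthonormalBasis_apply]
    exact (((hφ i).isWeingartenMap_iff (hu i) (ha' i).1 Li).1 hLi _ _ _ _ (hl i k).symm
      (hl i k').symm).symm
  · rw [← hoff i j hij, Matrix.transpose_submatrix, hsymm.eq]
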